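/- Let $m \ge 2$ and let $F$ be the finite field of order $3^m$, with absolute trace $\mathrm{Tr} : F \to \mathbb{F}_3$, $\mathrm{Tr}(x) = x + x^3 + \cdots + x^{3^{m-1}}$. For $a \in F^* = F \setminus \{0\}$ let $$K(a) = \sum_{x \in F} \omega^{\mathrm{Tr}(x + a/x)}, \qquad \omega = e^{2\pi i/3},$$ where $a/0$ is read as $0$ (so that $x = 0$ contributes $1$), and let $a^{1/3}$ be the unique cube root of $a$ in $F$. Let $E(a) = \{(x,y) \in F \times F : y^2 = x^3 + x^2 - a\}$. Let $a \in F^*$, and let $u_1, u_2, \ldots$ be a sequence of elements of $F$ such that $(u_1, y) \in E(a)$ for some $y \in F$ with $$\mathrm{Tr}\left(\frac{a\,y}{u_1^3}\right) \neq 0$$ (that is, $y$ is a square root of $u_1^3 + u_1^2 - a$ in $F$; the choice of its sign does not matter, and the quotient is read as $0$ if $u_1 = 0$, so the condition forces $u_1 \ne 0$), and such that $$u_{i+1} = \frac{(u_i^3 - a)^3 + a u_i^3}{(u_i^3 - a)^2}$$ for all $1 \le i \le m-1$ for which the denominator is nonzero, i.e. $u_i \neq a^{1/3}$ (no condition is put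 on $u_{i+1}$ if $u_i = a^{1/3}$). Then $K(a) = 0$ if and only if $u_m = a^{1/3}$ and $u_i \neq a^{1/3}$ for all $1 \le i \le m-1$. -/

import Mathlib

/-- The absolute trace `Tr(x) = x + x^3 + x^9 + ⋯` of a finite field of characteristic `3`,
with values in the prime field. -/
noncomputable def absTrace {F : Type*} [Field F] [Algebra (ZMod 3) F] (x : F) : ZMod 3 :=
  Algebra.trace (ZMod 3) F x

/-- The ternary Kloosterman sum `K(a) = ∑_{x ∈ F} ω ^ Tr(x + a / x)`, with `ω = exp(2πi/3)`.
The sum runs over all of `F`, and `a / 0 = 0`, so that `x = 0` contributes `1`. -/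
noncomputable def kloostermanSum {F : Type*} [Field F] [Fintype F] [Algebra (ZMod 3) F]
    (a : F) : ℂ :=
  ∑ x : F, Complex.exp (2 * Real.pi * Complex.I / 3) ^ (absTrace (x + a / x)).val

/-- The affine points of the elliptic curve `E(a) : y² = x³ + x² - a`. -/
def curveE {F : Type*} [Field F] (a : F) : Set (F × F) :=
  {P | P.2 ^ 2 = P.1 ^ 3 + P.1 ^ 2 - a}

/-- The unique cube root `a^{1/3}` of an element of a finite field of characteristic `3`. -/
noncomputable def cubeRoot {F : Type*} [Field F] [Finite F] [CharP F 3] (a : F) : F :=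
  (frobeniusEquiv F 3).symm a

/-!
The sum `K(a)` vanishes exactly when the elliptic curve `E(a) : y² = x³ + x² - a` has `q = 3 ^ m`
rational points, and the sequence `u` tests whether a given point has order `3 ^ m`.

The number of points of `E(a)`, with the one at infinity, is `q + K(a)`. To see this, count the
solutions of `t³ - t = x + a / x` with `x ≠ 0`. The trace condition for the solvability of `t³ - t
= s` expresses this count by `K(a)`. Solving for `x` instead expresses it by the sum of `χ((t³ -
t)² - a)` over `t` (`sum_artinSchreier`), where `χ` is the quadratic character. As `(t³ - t)² - a`
is a cubic polynomial in `w = t²`, the latter sum splits into a cubic and a quartic one, and in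
characteristic `3` elementary substitutions turn both into the sum that counts the points of
`E(a)` (`sum_sextic`). The trivial bounds for these sums give `|K(a)| < q`, so that `K(a) = 0` as
soon as `q` divides the number of points (`kloostermanSum_eq_zero_iff_dvd`).

The recursion for `u` is the tripling formula on abscissas (`three_nsmul_some`), and the points of
order three are those with abscissa `a^{1/3}`. Therefore `u` meets `a^{1/3}` first at the index
`m` if and only if the initial point `P` has order `3 ^ m`. If it does, `q` divides the number of
points. Conversely, if `E(a)` has `3 ^ m` points, its group has only three elements killed by `3`,
so that every element of smaller order is a triple (`exists_nsmul_eq_of_pow_nsmul_eq_zero`). But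
for a triple `(X, Y)` the element `a Y / X³` has the Artin–Schreier form `z - z³`
(`artinSchreier_of_three_nsmul`) and hence trace `0`, which the hypothesis on `P` excludes.
-/

open Finset

/-! ### Tripling on the curve -/

section

variable {F : Type*} [Field F]

/-- The curve `E(a) : y² = x³ + x² - a` as a Weierstrass curve, so that its points carry Mathlib's
group law. In characteristic `3` its discriminant is `a`. -/
def kloostermanCurve (a : F) : WeierstrassCurve.Affine F := ⟨0, 1, 0, 0, -a⟩

theorem kloostermanCurve_equation_iff {a x y : F} :
    (kloostermanCurve a).Equation x y ↔ y ^ 2 = x ^ 3 + x ^ 2 - a := by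
  simp [WeierstrassCurve.Affine.equation_iff, kloostermanCurve, sub_eq_add_neg]

theorem kloostermanCurve_nonsingular_iff [CharP F 3] {a x y : F} (ha : a ≠ 0) :
    (kloostermanCurve a).Nonsingular x y ↔ y ^ 2 = x ^ 3 + x ^ 2 - a := by
  rw [← WeierstrassCurve.Affine.equation_iff_nonsingular_of_Δ_ne_zero,
    kloostermanCurve_equation_iff]
  have h3 : (3 : F) = 0 := CharP.cast_eq_zero F 3
  have : (kloostermanCurve a).Δ = a := by
    simp only [kloostermanCurve, WeierstrassCurve.Δ, WeierstrassCurve.b₂, WeierstrassCurve.b₄,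
      WeierstrassCurve.b₆, WeierstrassCurve.b₈]
    linear_combination (21 * a - 144 * a ^ 2) * h3
  rwa [this]

theorem kloostermanCurve_negY (a x y : F) : (kloostermanCurve a).negY x y = -y := by
  simp [WeierstrassCurve.Affine.negY, kloostermanCurve]

theorem kloostermanCurve_addX (a x₁ x₂ l : F) :
    (kloostermanCurve a).addX x₁ x₂ l = l ^ 2 - 1 - x₁ - x₂ := by
  simp [WeierstrassCurve.Affine.addX, kloostermanCurve]

theorem ne_neg_of_ne_zero [CharP F 3] {y : F} (hy : y ≠ 0) : y ≠ -y := by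
  have h3 : (3 : F) = 0 := CharP.cast_eq_zero F 3
  intro h
  apply hy
  linear_combination y * h3 - h

theorem kloostermanCurve_slope_self [CharP F 3] [DecidableEq F] (a x : F) {y : F} (hy : y ≠ 0) :
    (kloostermanCurve a).slope x x y y = x / y := by
  have h3 : (3 : F) = 0 := CharP.cast_eq_zero F 3
  have hn := ne_neg_of_ne_zero hy
  rw [WeierstrassCurve.Affine.slope_of_Y_ne rfl (by rwa [kloostermanCurve_negY]),
    kloostermanCurve_negY, div_eq_div_iff (sub_ne_zero.2 hn) hy]
  simp only [kloostermanCurve]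
  linear_combination x ^ 2 * y * h3

/-- The points with `x³ = a` have `y² = x²`; doubling such a point gives its negative. -/
theorem three_nsmul_some_eq_zero [CharP F 3] [DecidableEq F] {a x y : F} (ha : a ≠ 0)
    (h : (kloostermanCurve a).Nonsingular x y) (hx : x ^ 3 = a) :
    3 • WeierstrassCurve.Affine.Point.some x y h = 0 := by
  have h3 : (3 : F) = 0 := CharP.cast_eq_zero F 3
  have hE := (kloostermanCurve_nonsingular_iff ha).1 h
  have hx0 : x ≠ 0 := by rintro rfl; exact ha (by simpa using hx.symm)
  have hyx : y ^ 2 = x ^ 2 := by rw [hE, hx]; ring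
  have hy : y ≠ 0 := by rintro rfl; exact hx0 (by simpa using hyx.symm)
  have hyn : y ≠ (kloostermanCurve a).negY x y := by
    rw [kloostermanCurve_negY]; exact ne_neg_of_ne_zero hy
  have hxy : ¬ (x = x ∧ y = (kloostermanCurve a).negY x y) := fun h => hyn h.2
  rw [succ_nsmul, two_nsmul, WeierstrassCurve.Affine.Point.add_some hxy]
  have hs := kloostermanCurve_slope_self a x hy
  have hX : (kloostermanCurve a).addX x x ((kloostermanCurve a).slope x x y y) = x := by
    rw [hs]
    rw [kloostermanCurve_addX, div_pow, ← hyx]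
    rw [div_self (pow_ne_zero 2 hy)]
    linear_combination (-x) * h3
  apply WeierstrassCurve.Affine.Point.add_of_Y_eq hX
  simp only [WeierstrassCurve.Affine.addY, WeierstrassCurve.Affine.negAddY, hX]
  simp

/-- The tripling formula away from the `3`-torsion. The right-hand side depends on `(x, y)` only
through `(x³, y³)`: tripling is Frobenius followed by the Verschiebung. -/
theorem three_nsmul_some [CharP F 3] [DecidableEq F] {a x y : F} (ha : a ≠ 0)
    (h : (kloostermanCurve a).Nonsingular x y) (hx : x ^ 3 - a ≠ 0) :
    ∃ h', 3 • WeierstrassCurve.Affine.Point.some x y h =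
      WeierstrassCurve.Affine.Point.some (((x ^ 3 - a) ^ 3 + a * x ^ 3) / (x ^ 3 - a) ^ 2)
        (y ^ 3 * (y ^ 6 - (x ^ 3 - a) ^ 2) / (x ^ 3 - a) ^ 3) h' := by
  have h3 : (3 : F) = 0 := CharP.cast_eq_zero F 3
  have hE := (kloostermanCurve_nonsingular_iff ha).1 h
  suffices H : ∃ X Y, ∃ h', 3 • WeierstrassCurve.Affine.Point.some x y h =
      WeierstrassCurve.Affine.Point.some X Y h' ∧
      X = ((x ^ 3 - a) ^ 3 + a * x ^ 3) / (x ^ 3 - a) ^ 2 ∧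
      Y = y ^ 3 * (y ^ 6 - (x ^ 3 - a) ^ 2) / (x ^ 3 - a) ^ 3 by
    obtain ⟨X, Y, h', he, rfl, rfl⟩ := H
    exact ⟨h', he⟩
  rw [succ_nsmul, two_nsmul]
  -- A point with `y = 0` has order two and is its own triple.
  by_cases hy : y = 0
  · have hx0 : x ≠ 0 := by rintro rfl; subst hy; apply ha; linear_combination hE
    have hc : x ^ 3 - a = - x ^ 2 := by rw [hy] at hE; linear_combination -hE
    rw [WeierstrassCurve.Affine.Point.add_self_of_Y_eq
      (by rw [kloostermanCurve_negY, hy, neg_zero]), zero_add]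
    refine ⟨_, _, h, rfl, ?_, by simp [hy]⟩
    rw [eq_div_iff (pow_ne_zero 2 hx), hc]
    linear_combination x ^ 3 * hc
  · have hyn : y ≠ (kloostermanCurve a).negY x y := by
      rw [kloostermanCurve_negY]; exact ne_neg_of_ne_zero hy
    have hxy : ¬ (x = x ∧ y = (kloostermanCurve a).negY x y) := fun h => hyn h.2
    have hs := kloostermanCurve_slope_self a x hy
    have hX : (kloostermanCurve a).addX x x ((kloostermanCurve a).slope x x y y) =
        x - (x ^ 3 - a) / y ^ 2 := by
      rw [hs]
      rw [kloostermanCurve_addX]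
      field_simp
      linear_combination -hE - y ^ 2 * x * h3
    have hY : (kloostermanCurve a).addY x x y ((kloostermanCurve a).slope x x y y) =
        x * (x ^ 3 - a) / y ^ 3 - y := by
      rw [WeierstrassCurve.Affine.addY, WeierstrassCurve.Affine.negAddY, hX, hs]
      rw [kloostermanCurve_negY]
      field_simp
      ring
    have hX' : (kloostermanCurve a).addX x x ((kloostermanCurve a).slope x x y y) ≠ x := by
      rw [hX, Ne, sub_eq_self]
      exact div_ne_zero hx (pow_ne_zero 2 hy)
    have hxy' : ¬ ((kloostermanCurve a).addX x x ((kloostermanCurve a).slope x x y y) = x ∧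
      (kloostermanCurve a).addY x x y ((kloostermanCurve a).slope x x y y) =
        (kloostermanCurve a).negY x y) := fun h => hX' h.1
    rw [WeierstrassCurve.Affine.Point.add_some hxy, WeierstrassCurve.Affine.Point.add_some hxy']
    refine ⟨_, _, _, rfl, ?_, ?_⟩
    all_goals
      have hs' : (kloostermanCurve a).slope
          ((kloostermanCurve a).addX x x ((kloostermanCurve a).slope x x y y)) x
          ((kloostermanCurve a).addY x x y ((kloostermanCurve a).slope x x y y)) y =
          - y ^ 3 / (x ^ 3 - a) - x / y := by
        rw [WeierstrassCurve.Affine.slope_of_X_ne hX', hX, hY]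
        have : x - (x ^ 3 - a) / y ^ 2 - x = - (x ^ 3 - a) / y ^ 2 := by ring
        rw [this]
        field_simp
        linear_combination y ^ 4 * h3
      have hX3 : (kloostermanCurve a).addX
          ((kloostermanCurve a).addX x x ((kloostermanCurve a).slope x x y y)) x
          (- y ^ 3 / (x ^ 3 - a) - x / y) =
          ((x ^ 3 - a) ^ 3 + a * x ^ 3) / (x ^ 3 - a) ^ 2 := by
        rw [hX]
        rw [kloostermanCurve_addX]
        field_simp
        grind
      rw [hs']
    · exact hX3
    · rw [WeierstrassCurve.Affine.addY, WeierstrassCurve.Affine.negAddY, hX3, hX, hY]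
      rw [kloostermanCurve_negY]
      field_simp
      grind

/-- If `(X, Y) = 3 • (x, y)`, then `a Y / X³` has the form `z - z³`. The witness
`z = a y³ / ((x³ - a)³ + a x³)` has simple poles at the points where `X = 0`; the Verschiebung
is the Artin–Schreier covering of `E(a)` given by `z³ - z = -a Y / X³`. -/
theorem artinSchreier_of_three_nsmul [CharP F 3] {a x y : F}
    (hE : y ^ 2 = x ^ 3 + x ^ 2 - a) :
    ∃ z : F, a * (y ^ 3 * (y ^ 6 - (x ^ 3 - a) ^ 2) / (x ^ 3 - a) ^ 3) /
      (((x ^ 3 - a) ^ 3 + a * x ^ 3) / (x ^ 3 - a) ^ 2) ^ 3 = z - z ^ 3 := by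
  have h3 : (3 : F) = 0 := CharP.cast_eq_zero F 3
  refine ⟨a * y ^ 3 / ((x ^ 3 - a) ^ 3 + a * x ^ 3), ?_⟩
  by_cases hD : (x ^ 3 - a) ^ 3 + a * x ^ 3 = 0
  · simp [hD]
  have hy : y ^ 6 = (x ^ 3) ^ 2 + (x ^ 3 - a) ^ 3 := by
    rw [show y ^ 6 = (y ^ 2) ^ 3 by ring, hE]
    grind
  -- The identity left to prove is polynomial in `T = x³` and `c = T - a` once `y⁶` is eliminated;
  -- it also holds with the junk values of division at `c = 0`, as then `y⁶ = a²` and `z = ± 1`.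
  generalize x ^ 3 = T at *
  generalize hc : T - a = c at *
  obtain rfl : a = T - c := by rw [← hc]; ring
  field_simp
  grind

end

/-! ### Abelian groups with small torsion -/

/-- Translation embeds a nonempty fibre of multiplication by `n` into the `n`-torsion. -/
theorem card_nsmul_fiber_le {G : Type*} [AddCommGroup G] [Fintype G] [DecidableEq G] (n : ℕ)
    (s : Finset G) (b : G) : #{x ∈ s | n • x = b} ≤ #{x : G | n • x = 0} := by
  rcases Finset.eq_empty_or_nonempty {x ∈ s | n • x = b} with h | ⟨x₀, h₀⟩
  · simp [h]
  · refine card_le_card_of_injOn (fun x => x - x₀) (fun x hx => ?_) (sub_left_injective.injOn)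
    simp only [coe_filter, Set.mem_ofPred_eq, mem_filter] at hx h₀
    simp [smul_sub, hx.2, h₀.2]

theorem card_pow_torsion_le {G : Type*} [AddCommGroup G] [Fintype G] [DecidableEq G] {p : ℕ}
    (h : #{x : G | p • x = 0} ≤ p) (k : ℕ) : #{x : G | p ^ k • x = 0} ≤ p ^ k := by
  induction k with
  | zero => simp [filter_eq']
  | succ k ih =>
    calc #{x : G | p ^ (k + 1) • x = 0} ≤ p * #{x : G | p ^ k • x = 0} :=
          card_le_mul_card_image_of_maps_to (f := fun x => p • x)
            (fun x hx => by simpa [pow_succ, mul_smul] using hx) _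
            (fun b _ => (card_nsmul_fiber_le p _ b).trans h)
      _ ≤ p * p ^ k := by gcongr
      _ = p ^ (k + 1) := by ring

/-- In an abelian group of order `p ^ (k + 1)` with at most `p` elements killed by `p`, every
element killed by `p ^ k` is a multiple of `p`: the image of multiplication by `p` lies in the `p
^ k`-torsion and has at least as many elements. -/
theorem exists_nsmul_eq_of_pow_nsmul_eq_zero {G : Type*} [AddCommGroup G] [Fintype G]
    [DecidableEq G] {p k : ℕ} (hp : 0 < p) (h : #{x : G | p • x = 0} ≤ p)
    (hG : Fintype.card G = p ^ (k + 1)) {P : G} (hP : p ^ k • P = 0) : ∃ Q, p • Q = P := by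
  have hsub : univ.image (fun x : G => p • x) ⊆ ({x : G | p ^ k • x = 0} : Finset G) := by
    intro y hy
    obtain ⟨x, -, rfl⟩ := mem_image.1 hy
    rw [mem_filter, ← mul_smul, ← pow_succ, ← hG]
    exact ⟨mem_univ _, card_nsmul_eq_zero⟩
  have hle : p ^ k ≤ #(univ.image (fun x : G => p • x)) := by
    refine Nat.le_of_mul_le_mul_left ?_ hp
    rw [← pow_succ', ← hG]
    exact card_le_mul_card_image _ _ fun b _ => (card_nsmul_fiber_le p _ b).trans h
  have heq := eq_of_subset_of_card_le hsub ((card_pow_torsion_le h k).trans hle)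
  have hmem : P ∈ univ.image (fun x : G => p • x) := by rw [heq]; simpa using hP
  simpa using hmem

/-! ### Kloosterman sums and Artin–Schreier equations -/

section

variable {F : Type*} [Field F] [Fintype F] [Algebra (ZMod 3) F]

/-- The canonical additive character `x ↦ ω ^ Tr x` of `F`, with `ω = exp(2πi/3)`; the exponent is
the representative of the trace in `{0, 1, 2}`. -/
noncomputable def traceChar (x : F) : ℂ :=
  Complex.exp (2 * Real.pi * Complex.I / 3) ^ (absTrace x).val

theorem absTrace_cube (x : F) : absTrace (x ^ 3) = absTrace x := by
  have := Algebra.trace_eq_of_algEquiv (FiniteField.frobeniusAlgEquivOfAlgebraic (ZMod 3) F) x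
  simpa [FiniteField.coe_frobeniusAlgEquivOfAlgebraic, absTrace] using this

theorem absTrace_artinSchreier (z : F) : absTrace (z ^ 3 - z) = 0 := by
  rw [absTrace, map_sub, ← absTrace, ← absTrace, absTrace_cube, sub_self]

theorem artinSchreier_eq_iff {F : Type*} [Field F] [CharP F 3] (t z : F) :
    t ^ 3 - t = z ^ 3 - z ↔ t = z ∨ t = z + 1 ∨ t = z - 1 := by
  have h3 : (3 : F) = 0 := CharP.cast_eq_zero F 3
  have : t ^ 3 - t - (z ^ 3 - z) = (t - z) * ((t - (z + 1)) * (t - (z - 1))) := by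
    linear_combination (t ^ 2 * z - t * z ^ 2) * h3
  rw [← sub_eq_zero, this, mul_eq_zero, mul_eq_zero, sub_eq_zero, sub_eq_zero, sub_eq_zero]

theorem card_artinSchreier_fiber {F : Type*} [Field F] [Fintype F] [CharP F 3] [DecidableEq F]
    (z : F) :
    #{t : F | t ^ 3 - t = z ^ 3 - z} = 3 := by
  have h3 : (3 : F) = 0 := CharP.cast_eq_zero F 3
  have : ({t : F | t ^ 3 - t = z ^ 3 - z} : Finset F) = {z, z + 1, z - 1} := by
    ext t; simp [artinSchreier_eq_iff]
  rw [this, card_eq_three]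
  refine ⟨_, _, _, by simp, fun h => ?_, fun h => ?_, rfl⟩
  · exact one_ne_zero (α := F) (by linear_combination h)
  · exact one_ne_zero (α := F) (by linear_combination h3 - h)

/-- The additive form of Hilbert 90: the image of `t ↦ t³ - t` lies in the kernel of the trace, and
both have index `3`. -/
theorem exists_artinSchreier_of_absTrace_eq_zero [CharP F 3] {s : F} (hs : absTrace s = 0) :
    ∃ t : F, t ^ 3 - t = s := by
  classical
  have hcube (x y : F) : (x + y) ^ 3 = x ^ 3 + y ^ 3 := add_pow_char ..
  let f : F →+ F := AddMonoidHom.mk' (fun t => t ^ 3 - t) (fun x y => by rw [hcube]; ring)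
  let T : F →+ ZMod 3 := (Algebra.trace (ZMod 3) F).toAddMonoidHom
  have hT : Function.Surjective T := Algebra.trace_surjective (ZMod 3) F
  have hle : f.range ≤ T.ker := by
    rintro _ ⟨z, rfl⟩
    exact absTrace_artinSchreier z
  have hf : Nat.card f.ker = 3 := by
    rw [← card_artinSchreier_fiber (0 : F), Nat.card_eq_fintype_card,
      Fintype.card_of_subtype]
    intro x
    simp [f, AddMonoidHom.mem_ker]
  have h1 := f.ker.card_mul_index
  rw [AddSubgroup.index_ker, hf] at h1
  have h2 := T.ker.card_mul_index
  rw [AddSubgroup.index_ker, AddMonoidHom.range_eq_top.2 hT, AddSubgroup.card_top,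
    Nat.card_zmod] at h2
  have heq : f.range = T.ker := AddSubgroup.eq_of_le_of_card_ge hle (by omega)
  have : s ∈ f.range := heq ▸ hs
  exact this

theorem card_artinSchreier [CharP F 3] [DecidableEq F] (s : F) :
    (#{t : F | t ^ 3 - t = s} : ℂ) = 1 + traceChar s + traceChar (-s) := by
  have hneg : absTrace (-s) = - absTrace s := by simp [absTrace]
  simp only [traceChar, hneg]
  set ω := Complex.exp (2 * Real.pi * Complex.I / 3) with hω
  have hprim : IsPrimitiveRoot ω 3 := Complex.isPrimitiveRoot_exp 3 (by norm_num)
  have hsum : 1 + ω + ω ^ 2 = 0 := by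
    simpa [Finset.sum_range_succ] using hprim.geom_sum_eq_zero (by norm_num)
  by_cases hs : absTrace s = 0
  · obtain ⟨z, rfl⟩ := exists_artinSchreier_of_absTrace_eq_zero hs
    rw [card_artinSchreier_fiber, hs]
    norm_num
  · have : ({t : F | t ^ 3 - t = s} : Finset F) = ∅ := by
      refine filter_eq_empty_iff.2 fun t _ ht => hs ?_
      rw [← ht, absTrace_artinSchreier]
    rw [this]
    generalize absTrace s = r at hs
    fin_cases r
    · exact absurd rfl hs
    · change _ = 1 + ω ^ 1 + ω ^ 2
      simp [hsum]
    · change _ = 1 + ω ^ 2 + ω ^ 1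
      rw [add_right_comm]; simp [hsum]

theorem kloostermanSum_eq (a : F) : kloostermanSum a = ∑ x : F, traceChar (x + a / x) := rfl

theorem sum_traceChar_neg (a : F) : ∑ x : F, traceChar (-(x + a / x)) = kloostermanSum a := by
  rw [kloostermanSum_eq, ← Equiv.sum_comp (Equiv.neg F)]
  refine Finset.sum_congr rfl fun x _ => ?_
  congr 1
  simp [div_neg]
  ring

/-- Since `4 = 1` in characteristic `3`, the discriminant of `x² - s x + a` is `s² - a`. -/
theorem card_roots_quadratic {F : Type*} [Field F] [Fintype F] [CharP F 3] [DecidableEq F]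
    {a : F} (s : F) :
    (#{x : F | x ^ 2 - s * x + a = 0} : ℤ) = quadraticChar F (s ^ 2 - a) + 1 := by
  have h3 : (3 : F) = 0 := CharP.cast_eq_zero F 3
  have h2 : ringChar F ≠ 2 := by rw [ringChar.eq F 3]; norm_num
  rw [← quadraticChar_card_sqrts h2, Nat.cast_inj]
  refine card_bij (fun x _ => x + s) (fun x hx => ?_) (fun x _ y _ h => add_right_cancel h)
    (fun y hy => ⟨y - s, ?_, by simp⟩)
  · simp only [mem_filter, mem_univ, true_and, Set.mem_toFinset, Set.mem_ofPred_eq] at hx ⊢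
    linear_combination hx + s * x * h3
  · simp only [mem_filter, mem_univ, true_and, Set.mem_toFinset, Set.mem_ofPred_eq] at hy ⊢
    linear_combination hy - (s * y - s ^ 2) * h3

/-- Both sides count, up to elementary terms, the solutions `(x, t)` of `t³ - t = x + a / x` with
`x ≠ 0`: for fixed `x` by the trace condition on `x + a / x`, for fixed `t` as the roots of a
quadratic polynomial in `x`. -/
theorem sum_artinSchreier [CharP F 3] [DecidableEq F] {a : F} (ha : a ≠ 0) :
    2 * kloostermanSum a - 3 =
      ((∑ t : F, quadraticChar F ((t ^ 3 - t) ^ 2 - a) : ℤ) : ℂ) := by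
  have h1 : ∑ t : F, (#{x : F | x ^ 2 - (t ^ 3 - t) * x + a = 0} : ℂ) =
      ∑ x ∈ univ.erase (0 : F), (#{t : F | t ^ 3 - t = x + a / x} : ℂ) := by
    norm_cast
    simp only [card_filter]
    rw [sum_comm]
    symm
    -- The omitted term `x = 0` is not a root of `x² - (t³ - t) x + a`, because `a ≠ 0`.
    apply sum_subset_zero_on_sdiff (erase_subset _ _)
    · intro x hx
      have : x = 0 := by simpa using hx
      simp [this, ha]
    · intro x hx
      have hx0 : x ≠ 0 := by simpa using hx
      refine sum_congr rfl fun t _ => if_congr ?_ rfl rfl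
      rw [eq_comm, ← sub_eq_zero, ← mul_eq_zero_iff_right hx0]
      field_simp
      constructor <;> intro h <;> linear_combination h
  have h2 : ∑ x ∈ univ.erase (0 : F), (#{t : F | t ^ 3 - t = x + a / x} : ℂ) =
      2 * kloostermanSum a + Fintype.card F - 3 := by
    rw [← add_left_inj (1 + traceChar (0 + a / 0) + traceChar (-(0 + a / 0)))]
    simp only [card_artinSchreier]
    rw [sum_erase_add _ _ (mem_univ (0 : F)), sum_add_distrib, sum_add_distrib, ← kloostermanSum_eq,
      sum_traceChar_neg]
    simp [traceChar, absTrace]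
    ring
  have h3 : ∑ t : F, (#{x : F | x ^ 2 - (t ^ 3 - t) * x + a = 0} : ℂ) =
      ((∑ t : F, quadraticChar F ((t ^ 3 - t) ^ 2 - a) : ℤ) : ℂ) + Fintype.card F := by
    have (t : F) : (#{x : F | x ^ 2 - (t ^ 3 - t) * x + a = 0} : ℂ) =
        ((quadraticChar F ((t ^ 3 - t) ^ 2 - a) + 1 : ℤ) : ℂ) := by
      rw [← card_roots_quadratic]; norm_cast
    simp only [this]
    push_cast
    simp [sum_add_distrib]
  linear_combination h3 - h1 - h2

end

/-! ### Quadratic character sums -/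

section

variable {F : Type*} [Field F] [Fintype F]

/-- Substitution of `w = t²` in a sum: `w` has `χ(w) + 1` square roots. -/
theorem sum_comp_sq [CharP F 3] [DecidableEq F] (f : F → ℤ) :
    ∑ t : F, f (t ^ 2) = ∑ w : F, (quadraticChar F w + 1) * f w := by
  have h2 : ringChar F ≠ 2 := by rw [ringChar.eq F 3]; norm_num
  rw [← sum_fiberwise univ (fun t : F => t ^ 2)]
  refine sum_congr rfl fun w _ => ?_
  rw [sum_congr rfl (g := fun _ => f w) (fun t ht => by rw [(mem_filter.1 ht).2]), sum_const,
    nsmul_eq_mul, ← quadraticChar_card_sqrts h2]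
  congr 3
  ext; simp

/-- The sum `∑ χ(x³ + x² - a)` over `F`, for the quadratic character `χ`. Up to sign it is the
trace of Frobenius of `E(a)`. -/
def cubicCharSum [DecidableEq F] (a : F) : ℤ := ∑ x : F, quadraticChar F (x ^ 3 + x ^ 2 - a)

theorem cubicCharSum_cube [CharP F 3] [DecidableEq F] (a : F) :
    cubicCharSum (a ^ 3) = cubicCharSum a := by
  rw [cubicCharSum, ← Equiv.sum_comp (frobeniusEquiv F 3).toEquiv]
  refine sum_congr rfl fun x _ => ?_
  have : (x ^ 3) ^ 3 + (x ^ 3) ^ 2 - a ^ 3 = (x ^ 3 + x ^ 2 - a) ^ 3 := by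
    have h3 : (3 : F) = 0 := CharP.cast_eq_zero F 3
    grind
  have h (b : F) : quadraticChar F (b ^ 3) = quadraticChar F b := by
    rcases eq_or_ne b 0 with rfl | hb
    · simp
    · rw [pow_succ, map_mul, quadraticChar_sq_one' hb, one_mul]
  simp [frobenius_def, this, h]

/-- The translation `w ↦ w + 1` removes the linear term. -/
theorem sum_shifted_cubic [CharP F 3] [DecidableEq F] (a : F) :
    ∑ w : F, quadraticChar F (w ^ 3 + w ^ 2 + w - a) = cubicCharSum a := by
  rw [← Equiv.sum_comp (Equiv.addRight (1 : F)), cubicCharSum]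
  refine sum_congr rfl fun x _ => ?_
  congr 1
  have h3 : (3 : F) = 0 := CharP.cast_eq_zero F 3
  simp only [Equiv.coe_addRight]
  linear_combination (x ^ 2 + 2 * x + 1) * h3

/-- The curve `y² = w (w³ + w² + w - a)` becomes `E(a³)`, a Frobenius twist of `E(a)`, under
`w = 1 / v`, `v = (a - s) / a`. The value `v = 0` is not attained and accounts for the `-1`. -/
theorem sum_quartic [CharP F 3] [DecidableEq F] {a : F} (ha : a ≠ 0) :
    ∑ w : F, quadraticChar F w * quadraticChar F (w ^ 3 + w ^ 2 + w - a) = cubicCharSum a - 1 := by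
  have h3 : (3 : F) = 0 := CharP.cast_eq_zero F 3
  have hinv : ∑ w : F, quadraticChar F w * quadraticChar F (w ^ 3 + w ^ 2 + w - a) =
      ∑ v ∈ univ.erase (0 : F), quadraticChar F (1 + v + v ^ 2 - a * v ^ 3) := by
    rw [← Equiv.sum_comp (Equiv.inv F), ← add_sum_erase _ _ (mem_univ (0 : F))]
    simp only [Equiv.inv_apply, inv_zero, MulChar.map_zero, zero_mul, zero_add]
    refine sum_congr rfl fun v hv => ?_
    have hv0 : v ≠ 0 := by simpa using hv
    rw [← map_mul, ← one_mul (quadraticChar F (v⁻¹ * _)),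
      ← quadraticChar_sq_one' (pow_ne_zero 2 hv0), ← map_mul]
    congr 1
    field_simp
  have hcubic : ∑ v : F, quadraticChar F (1 + v + v ^ 2 - a * v ^ 3) = cubicCharSum (a ^ 3) := by
    rw [← Equiv.sum_comp ((Equiv.addRight (-a)).trans
      (Equiv.mulLeft₀ (-a)⁻¹ (by simpa using ha))), cubicCharSum]
    refine sum_congr rfl fun s _ => ?_
    rw [← one_mul (quadraticChar F (1 + _ + _ - _)), ← quadraticChar_sq_one' ha, ← map_mul]
    congr 1
    change a ^ 2 * (1 + (-a)⁻¹ * (s + -a) + ((-a)⁻¹ * (s + -a)) ^ 2 -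
      a * ((-a)⁻¹ * (s + -a)) ^ 3) = _
    field_simp
    linear_combination (a ^ 2 - a * s + a * s * (a - s)) * h3
  rw [hinv, ← cubicCharSum_cube, ← hcubic, ← add_sum_erase _ _ (mem_univ (0 : F))]
  simp

/-- The substitution `w = t²` splits the sum for `y² = (t³ - t)² - a` into the sums of two curves,
each with the same number of points as `E(a)`. -/
theorem sum_sextic [CharP F 3] [DecidableEq F] {a : F} (ha : a ≠ 0) :
    ∑ t : F, quadraticChar F ((t ^ 3 - t) ^ 2 - a) = 2 * cubicCharSum a - 1 := by
  have h3 : (3 : F) = 0 := CharP.cast_eq_zero F 3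
  have (t : F) : (t ^ 3 - t) ^ 2 - a = (t ^ 2) ^ 3 + (t ^ 2) ^ 2 + t ^ 2 - a := by
    linear_combination (- t ^ 4) * h3
  simp only [this]
  rw [sum_comp_sq (fun w => quadraticChar F (w ^ 3 + w ^ 2 + w - a))]
  simp only [add_mul, one_mul, sum_add_distrib]
  rw [sum_shifted_cubic, sum_quartic ha]
  ring

theorem abs_sum_quadraticChar_le [DecidableEq F] (f : F → F) :
    |∑ x : F, quadraticChar F (f x)| ≤ Fintype.card F := by
  refine (abs_sum_le_sum_abs _ _).trans ?_
  calc ∑ x : F, |quadraticChar F (f x)| ≤ ∑ _x : F, (1 : ℤ) := sum_le_sum fun x _ => by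
        rcases eq_or_ne (f x) 0 with h | h
        · simp [h]
        · rcases quadraticChar_dichotomy h with h | h <;> simp [h]
    _ = Fintype.card F := by simp

theorem card_cubic_points [CharP F 3] [DecidableEq F] (a : F) :
    (Nat.card {P : F × F // P.2 ^ 2 = P.1 ^ 3 + P.1 ^ 2 - a} : ℤ) =
      Fintype.card F + cubicCharSum a := by
  have h2 : ringChar F ≠ 2 := by rw [ringChar.eq F 3]; norm_num
  have hx (x : F) : (#{y : F | y ^ 2 = x ^ 3 + x ^ 2 - a} : ℤ) =
      quadraticChar F (x ^ 3 + x ^ 2 - a) + 1 := by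
    rw [← quadraticChar_card_sqrts h2]
    congr 2
    ext; simp
  rw [Nat.card_eq_fintype_card, Fintype.card_subtype, card_filter, Fintype.sum_prod_type]
  simp only [← card_filter]
  push_cast
  simp only [hx, sum_add_distrib]
  simp [cubicCharSum, add_comm]

end

/-! ### The group of rational points -/

section

variable {F : Type*} [Field F] [Fintype F]


theorem eq_cubeRoot_iff [CharP F 3] {a x : F} : x = cubeRoot a ↔ x ^ 3 = a := by
  rw [cubeRoot, ← (frobeniusEquiv F 3).injective.eq_iff, RingEquiv.apply_symm_apply,
    frobeniusEquiv_apply, frobenius_def]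

instance finite_kloostermanCurve_point (a : F) : Finite (kloostermanCurve a).Point :=
  have : Finite (WithZero {P : F × F // (kloostermanCurve a).Nonsingular P.1 P.2}) :=
    inferInstanceAs (Finite (Option _))
  Finite.of_equiv _ (WeierstrassCurve.Affine.nonsingularPointEquiv (kloostermanCurve a)).symm

theorem card_kloostermanCurve_point [CharP F 3] [DecidableEq F] {a : F} (ha : a ≠ 0) :
    (Nat.card (kloostermanCurve a).Point : ℤ) = Fintype.card F + cubicCharSum a + 1 := by
  have h1 : Nat.card (kloostermanCurve a).Point =
      Nat.card {P : F × F // P.2 ^ 2 = P.1 ^ 3 + P.1 ^ 2 - a} + 1 := by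
    rw [Nat.card_congr (WeierstrassCurve.Affine.nonsingularPointEquiv (kloostermanCurve a))]
    rw [← Finite.card_option]
    exact Nat.card_congr (Equiv.optionCongr
      (Equiv.subtypeEquivRight fun P => kloostermanCurve_nonsingular_iff ha))
  rw [h1, Nat.cast_add, card_cubic_points, Nat.cast_one]

/-- The `3`-torsion consists of `0` and the points `(r, ± r)` with `r = a^{1/3}`. -/
theorem card_three_torsion_le [CharP F 3] [DecidableEq F] {a : F} (ha : a ≠ 0)
    [Fintype (kloostermanCurve a).Point] :
    #{P : (kloostermanCurve a).Point | 3 • P = 0} ≤ 3 := by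
  set r := cubeRoot a with hr
  have hr3 : r ^ 3 = a := eq_cubeRoot_iff.1 hr
  have hr0 : r ≠ 0 := by
    intro h
    rw [h] at hr3
    exact ha (by simpa using hr3.symm)
  have key : ∀ P : (kloostermanCurve a).Point, 3 • P = 0 →
      P = 0 ∨ ∃ y h, P = .some r y h ∧ (y = r ∨ y = -r) := by
    rintro (_ | ⟨x, y, h⟩) hP
    · exact Or.inl rfl
    · right
      have hx : x ^ 3 = a := by
        by_contra hx
        obtain ⟨h', h3⟩ := three_nsmul_some ha h (sub_ne_zero.2 hx)
        rw [h3] at hP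
        exact WeierstrassCurve.Affine.Point.some_ne_zero h' hP
      obtain rfl : x = r := eq_cubeRoot_iff.2 hx
      refine ⟨y, h, rfl, sq_eq_sq_iff_eq_or_eq_neg.1 ?_⟩
      rw [(kloostermanCurve_nonsingular_iff ha).1 h, hx]
      ring
  -- On the `3`-torsion a point is determined by its ordinate, with `0` standing for infinity.
  let f : (kloostermanCurve a).Point → F
    | .zero => 0
    | .some _ y _ => y
  refine (card_le_card_of_injOn f (t := {0, r, -r}) ?_ ?_).trans card_le_three
  · intro P hP
    rcases key P (by simpa using hP) with rfl | ⟨y, h, rfl, rfl | rfl⟩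
    · exact mem_insert_self _ _
    all_goals simp [f]
  · intro P hP Q hQ hPQ
    rcases key P (by simpa using hP) with rfl | ⟨y, h, rfl, hy⟩ <;>
    rcases key Q (by simpa using hQ) with rfl | ⟨y', h', rfl, hy'⟩
    · rfl
    · have : (0 : F) = y' := hPQ
      rcases hy' with rfl | rfl
      · exact absurd this.symm hr0
      · exact absurd this.symm (neg_ne_zero.2 hr0)
    · have : y = (0 : F) := hPQ
      rcases hy with rfl | rfl
      · exact absurd this hr0
      · exact absurd this (neg_ne_zero.2 hr0)
    · have : y = y' := hPQ
      subst this
      rfl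

variable [Algebra (ZMod 3) F]

/-- With `card_kloostermanCurve_point`, this says that `E(a)` has `#F + K(a)` points, including
the one at infinity. -/
theorem kloostermanSum_eq_cubicCharSum [CharP F 3] [DecidableEq F] {a : F} (ha : a ≠ 0) :
    kloostermanSum a = ((cubicCharSum a + 1 : ℤ) : ℂ) := by
  have h := sum_artinSchreier ha
  rw [sum_sextic ha] at h
  push_cast at h ⊢
  linear_combination h / 2

/-- Divisibility suffices: `K(a)` differs from the number of points by `q = #F`, and the trivial
bounds for the character sums give `-q < K(a)` and `2 K(a) - 3 ≤ q`, hence `|K(a)| < q`. -/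
theorem kloostermanSum_eq_zero_iff_dvd [CharP F 3] {a : F} (ha : a ≠ 0)
    (hF : 3 < Fintype.card F) :
    kloostermanSum a = 0 ↔ Fintype.card F ∣ Nat.card (kloostermanCurve a).Point := by
  classical
  have hcard := card_kloostermanCurve_point ha
  have hbound := abs_le.1 (abs_sum_quadraticChar_le fun t : F => (t ^ 3 - t) ^ 2 - a)
  have hlow : -(Fintype.card F : ℤ) ≤ cubicCharSum a := (abs_le.1 (abs_sum_quadraticChar_le _)).1
  rw [sum_sextic ha] at hbound
  rw [kloostermanSum_eq_cubicCharSum ha, Int.cast_eq_zero, ← Int.natCast_dvd_natCast, hcard,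
    add_assoc, dvd_add_right dvd_rfl]
  constructor
  · intro h
    rw [h]
    exact dvd_zero _
  · intro h
    refine Int.eq_zero_of_abs_lt_dvd h ?_
    rw [abs_lt]
    omega

/-- The trace condition obstructs divisibility by `3` in the group of points. -/
theorem three_nsmul_ne_some_of_absTrace_ne_zero [CharP F 3] [DecidableEq F] {a x y : F}
    (ha : a ≠ 0) (h : (kloostermanCurve a).Nonsingular x y) (hTr : absTrace (a * y / x ^ 3) ≠ 0)
    (Q : (kloostermanCurve a).Point) : 3 • Q ≠ .some x y h := by
  intro hQ
  rcases Q with _ | ⟨x', y', h'⟩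
  · rw [← WeierstrassCurve.Affine.Point.zero_def, smul_zero] at hQ
    exact WeierstrassCurve.Affine.Point.some_ne_zero h hQ.symm
  · by_cases hx : x' ^ 3 = a
    · rw [three_nsmul_some_eq_zero ha h' hx] at hQ
      exact WeierstrassCurve.Affine.Point.some_ne_zero h hQ.symm
    · obtain ⟨h'', h3⟩ := three_nsmul_some ha h' (sub_ne_zero.2 hx)
      rw [h3, WeierstrassCurve.Affine.Point.some.injEq] at hQ
      obtain ⟨z, hz⟩ := artinSchreier_of_three_nsmul ((kloostermanCurve_nonsingular_iff ha).1 h')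
      rw [hQ.1, hQ.2] at hz
      apply hTr
      rw [hz, ← neg_sub, absTrace, map_neg, ← absTrace, absTrace_artinSchreier, neg_zero]

/-- As long as the sequence has not met `a^{1/3}`, it consists of the abscissas of the points
`3 ^ i • P`. -/
theorem pow_nsmul_eq_some {F : Type*} [Field F] [Fintype F] [CharP F 3] [DecidableEq F]
    {a y : F} (ha : a ≠ 0) {m : ℕ} {u : ℕ → F}
    (h : (kloostermanCurve a).Nonsingular (u 1) y)
    (hrec : ∀ i : ℕ, 1 ≤ i → i < m → (u i ^ 3 - a) ^ 2 ≠ 0 →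
      u (i + 1) = ((u i ^ 3 - a) ^ 3 + a * u i ^ 3) / (u i ^ 3 - a) ^ 2)
    (i : ℕ) (him : i < m) (hi : ∀ j, 1 ≤ j → j ≤ i → u j ≠ cubeRoot a) :
    ∃ y' h', 3 ^ i • WeierstrassCurve.Affine.Point.some (u 1) y h =
      WeierstrassCurve.Affine.Point.some (u (i + 1)) y' h' := by
  induction i with
  | zero => exact ⟨y, h, by simp⟩
  | succ i ih =>
    obtain ⟨y', h', he⟩ := ih (by omega) fun j h1 h2 => hi j h1 (by omega)
    have hne : u (i + 1) ^ 3 - a ≠ 0 :=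
      sub_ne_zero.2 fun hc => hi (i + 1) (by omega) le_rfl (eq_cubeRoot_iff.2 hc)
    obtain ⟨h'', h3⟩ := three_nsmul_some ha h' hne
    have hu := hrec (i + 1) (by omega) him (pow_ne_zero 2 hne)
    rw [pow_succ', mul_smul, he, h3]
    exact ⟨_, hu ▸ h'', by congr 1; exact hu.symm⟩

end

theorem corollary1 {F : Type*} [Field F] [Fintype F] [CharP F 3] [Algebra (ZMod 3) F]
    (m : ℕ) (hm : 2 ≤ m) (hcard : Fintype.card F = 3 ^ m)
    (a : F) (ha : a ≠ 0)
    (u : ℕ → F) (y : F)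
    (hE : (u 1, y) ∈ curveE a)
    (hTr : absTrace (a * y / u 1 ^ 3) ≠ 0)
    (hrec : ∀ i : ℕ, 1 ≤ i → i < m → (u i ^ 3 - a) ^ 2 ≠ 0 →
      u (i + 1) = ((u i ^ 3 - a) ^ 3 + a * u i ^ 3) / (u i ^ 3 - a) ^ 2) :
    kloostermanSum a = 0 ↔
      u m = cubeRoot a ∧ ∀ i : ℕ, 1 ≤ i → i ≤ m - 1 → u i ≠ cubeRoot a := by
  classical
  obtain ⟨k, rfl⟩ : ∃ k, m = k + 1 := ⟨m - 1, by omega⟩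
  rw [Nat.add_sub_cancel]
  have : Fintype (kloostermanCurve a).Point := Fintype.ofFinite _
  have hF : 3 < Fintype.card F := by
    rw [hcard]
    exact lt_self_pow₀ (by norm_num) (by omega)
  have h : (kloostermanCurve a).Nonsingular (u 1) y := (kloostermanCurve_nonsingular_iff ha).2 hE
  constructor
  · intro hK
    have hG : Fintype.card (kloostermanCurve a).Point = 3 ^ (k + 1) := by
      rw [kloostermanSum_eq_cubicCharSum ha, Int.cast_eq_zero] at hK
      have := card_kloostermanCurve_point ha
      rw [Nat.card_eq_fintype_card, add_assoc, hK, add_zero, hcard] at this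
      exact_mod_cast this
    -- The group has order `3 ^ (k + 1)` and `P` is not a triple, so `P` has full order.
    have hP : 3 ^ k • WeierstrassCurve.Affine.Point.some (u 1) y h ≠ 0 := by
      intro hP
      obtain ⟨Q, hQ⟩ := exists_nsmul_eq_of_pow_nsmul_eq_zero (by norm_num)
        (card_three_torsion_le ha) hG hP
      exact three_nsmul_ne_some_of_absTrace_ne_zero ha h hTr Q hQ
    have hne : ∀ i, 1 ≤ i → i ≤ k → u i ≠ cubeRoot a := by
      intro i
      induction i using Nat.strong_induction_on with
      | _ i ih =>
        intro h1 hi hu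
        obtain ⟨j, rfl⟩ : ∃ j, i = j + 1 := ⟨i - 1, by omega⟩
        obtain ⟨y', h', he⟩ := pow_nsmul_eq_some ha h hrec j (by omega)
          fun l hl hlj => ih l (by omega) hl (by omega)
        apply hP
        rw [← Nat.sub_add_cancel hi, pow_add, mul_smul, pow_succ', mul_smul, he,
          three_nsmul_some_eq_zero ha h' (eq_cubeRoot_iff.1 hu), smul_zero]
    refine ⟨?_, hne⟩
    obtain ⟨y', h', he⟩ := pow_nsmul_eq_some ha h hrec k (by omega) hne
    by_contra hu
    obtain ⟨h'', h3⟩ := three_nsmul_some ha h'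
      (sub_ne_zero.2 fun hc => hu (eq_cubeRoot_iff.2 hc))
    apply WeierstrassCurve.Affine.Point.some_ne_zero h''
    rw [← h3, ← he, ← mul_smul, ← pow_succ', ← hG, card_nsmul_eq_zero]
  -- Conversely `P` has order exactly `3 ^ (k + 1)`, which therefore divides the number of points.
  · rintro ⟨hu, hne⟩
    obtain ⟨y', h', he⟩ := pow_nsmul_eq_some ha h hrec k (by omega) hne
    have : Fact (Nat.Prime 3) := ⟨Nat.prime_three⟩
    have hord : addOrderOf (WeierstrassCurve.Affine.Point.some (u 1) y h) = 3 ^ (k + 1) := by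
      apply addOrderOf_eq_prime_pow
      · rw [he]
        exact WeierstrassCurve.Affine.Point.some_ne_zero h'
      · rw [pow_succ', mul_smul, he, three_nsmul_some_eq_zero ha h' (eq_cubeRoot_iff.1 hu)]
    rw [kloostermanSum_eq_zero_iff_dvd ha hF, hcard, ← hord]
    exact addOrderOf_dvd_natCard _
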